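/- For natural numbers $k, N \geq 1$, let $F_k(N)$ denote the cardinality of the largest subset of $\{1,\dots,N\}$ that does not contain $k$ distinct elements whose product is a perfect square, and set $$ c_k^- = \liminf_{N \to \infty} \left(1 - \frac{F_k(N)}{N}\right), \qquad c_k^+ = \limsup_{N \to \infty} \left(1 - \frac{F_k(N)}{N}\right). $$ Then for every $k \geq 4$ one has $c_k^+ \geq c_k^- > 0$. In other words, for every $k \geq 4$ there is a constant $c_k > 0$ such that $$ F_k(N) \leq (1 - c_k + o(1)) N \quad \text{as } N \to \infty, $$ where $o(1)$ denotes a quantity that tends to $0$ as $N \to \infty$ with $k$ held fixed. In particular, for every odd $k \geq 5$ it is not the case that $F_k(N) = (1 - o(1)) N$ as $N \to \infty$, which answers a question of Erdős in the negative. -/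

import Mathlib

open Filter Topology

/-- `A` contains no `k` distinct elements whose product is a perfect square. -/
def SquareProductFree (k : ℕ) (A : Finset ℕ) : Prop :=
  ∀ B : Finset ℕ, B ⊆ A → B.card = k → ¬ IsSquare (∏ n ∈ B, n)

open Classical in
/-- `F_k(N)`: the largest cardinality of a subset of `{1, …, N}` that contains no `k` distinct
elements whose product is a perfect square. -/
noncomputable def sqFreeMax (k N : ℕ) : ℕ :=
  ((Finset.Icc 1 N).powerset.filter (fun A => SquareProductFree k A)).sup Finset.card

/-- The lower density defect `c_k^- = liminf (1 - F_k(N) / N)`.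
The sequence takes values in `[0, 1]`, so this is the usual lower limit. -/
noncomputable def cMinus (k : ℕ) : ℝ :=
  liminf (fun N : ℕ => 1 - (sqFreeMax k N : ℝ) / (N : ℝ)) atTop

/-- The upper density defect `c_k^+ = limsup (1 - F_k(N) / N)`.
The sequence takes values in `[0, 1]`, so this is the usual upper limit. -/
noncomputable def cPlus (k : ℕ) : ℝ :=
  limsup (fun N : ℕ => 1 - (sqFreeMax k N : ℝ) / (N : ℝ)) atTop

open scoped ArithmeticFunction.Omega

/-! The core is `k = 5`. Label the ten edges of the complete graph on five vertices by natural
numbers and multiply the labels at each vertex. Every edge has two ends, so the five vertex products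
multiply to a square. If they are distinct and at most `N`, at least one of them must lie outside a
square-product-free set `A`. A weighted double count of labellings then bounds `S = {1, …, N} \ A`
from below.

A label is weighted through `x = p m` with `m ≤ 4 ^ h`, by `4 ^ (-Ω m) log p`. The factor `log p`
lets Chebyshev's bounds evaluate the mass of a box at scale `4 ^ j`: it is `4 ^ j F` up to
constants, where `F = ∑ 4 ^ (-Ω m) / m` satisfies `F ^ 4 ≥ h / 2`. The factor `4 ^ (-Ω)` offsets the
at most `4 ^ Ω n` ways to split a vertex product `n` into four labels, so each `n` receives mass at
most `(4 log N) ^ 4` per choice of scales.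

The scales form a five-parameter family with fixed vertex sizes near `4 ^ (20 h)`. The labels at one
vertex leave only two parameters free. Hence `SquareProductFree.mass_le`, which up to constants
reads `h ^ 5 4 ^ (50 h) F ^ 10 ≪ F ^ 6 4 ^ (30 h) h ^ 2 |S| (log N) ^ 4`. With `F ^ 4 ≫ h` and `log
N ≪ h`, all powers of `h` cancel and `|S| ≫ 4 ^ (20 h) ≫ N`.

Other `k` follow by steps of two from `0` or `5`, adjoining a pair `b, 4 b`
(`HasSquareProductDefect.add_two`). -/

lemma Finset.sum_le_sum_of_injOn_of_nonneg {α β : Type*} {s : Finset α} {t : Finset β}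
    {f : α → ℝ} {g : β → ℝ} (i : α → β) (hi : Set.InjOn i s) (hst : ∀ a ∈ s, i a ∈ t)
    (hfg : ∀ a ∈ s, f a ≤ g (i a)) (hg : ∀ b ∈ t, 0 ≤ g b) :
    ∑ a ∈ s, f a ≤ ∑ b ∈ t, g b := by
  classical
  calc ∑ a ∈ s, f a ≤ ∑ a ∈ s, g (i a) := Finset.sum_le_sum hfg
    _ = ∑ b ∈ s.image i, g b := (Finset.sum_image hi).symm
    _ ≤ ∑ b ∈ t, g b := Finset.sum_le_sum_of_subset_of_nonneg
        (Finset.image_subset_iff.2 hst) fun b hb _ => hg b hb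

/-! ### Multiplicative weights and ordered factorizations -/

/-- The completely multiplicative weight `4 ^ (-Ω n)`. -/
noncomputable def quarterOmega (n : ℕ) : ℝ := (1 / 4) ^ Ω n

lemma quarterOmega_pos (n : ℕ) : 0 < quarterOmega n := by
  unfold quarterOmega; positivity

lemma quarterOmega_mul {m n : ℕ} (hm : m ≠ 0) (hn : n ≠ 0) :
    quarterOmega (m * n) = quarterOmega m * quarterOmega n := by
  simp only [quarterOmega, ArithmeticFunction.cardFactors_mul hm hn, pow_add]

lemma quarterOmega_prime {p : ℕ} (hp : p.Prime) : quarterOmega p = 1 / 4 := by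
  simp [quarterOmega, ArithmeticFunction.cardFactors_apply_prime hp]

lemma quarterOmega_prod {ι : Type*} (s : Finset ι) (u : ι → ℕ) (hu : ∀ a ∈ s, u a ≠ 0) :
    quarterOmega (∏ a ∈ s, u a) = ∏ a ∈ s, quarterOmega (u a) := by
  classical
  induction s using Finset.induction_on with
  | empty => simp [quarterOmega]
  | insert a s ha ih =>
    have h1 := hu a (Finset.mem_insert_self _ _)
    have h2 : ∀ b ∈ s, u b ≠ 0 := fun b hb => hu b (Finset.mem_insert_of_mem hb)
    rw [Finset.prod_insert ha, Finset.prod_insert ha,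
      quarterOmega_mul h1 (Finset.prod_ne_zero_iff.2 h2), ih h2]

/-- The number of ordered factorizations of `n` into `d` factors is at most `d ^ Ω n`. -/
lemma card_finMulAntidiag_le (d : ℕ) {n : ℕ} (hn : n ≠ 0) :
    (Nat.finMulAntidiag d n).card ≤ d ^ Ω n := by
  induction n using induction_on_primes with
  | zero => exact absurd rfl hn
  | one => simp [Nat.finMulAntidiag_one]
  | prime_mul p a hp ih =>
    have ha : a ≠ 0 := right_ne_zero_of_mul hn
    -- A factorization of `p * a` arises from one of `a` by multiplying one of the `d` factors by
    -- `p`.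
    have hsub : Nat.finMulAntidiag d (p * a) ⊆
        ((Finset.univ : Finset (Fin d)) ×ˢ Nat.finMulAntidiag d a).image
          (fun q => Function.update q.2 q.1 (p * q.2 q.1)) := by
      intro u hu
      obtain ⟨hu, -⟩ := Nat.mem_finMulAntidiag.1 hu
      obtain ⟨i, -, hi⟩ := (hp.prime.dvd_finsetProd_iff u).1 (hu ▸ dvd_mul_right p a)
      obtain ⟨v, hv⟩ := hi
      refine Finset.mem_image.2 ⟨(i, Function.update u i v), ?_, ?_⟩
      · simp only [Finset.mem_product, Finset.mem_univ, true_and, Nat.mem_finMulAntidiag]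
        refine ⟨?_, ha⟩
        apply Nat.eq_of_mul_eq_mul_left hp.pos
        rw [← hu, Finset.prod_update_of_mem (Finset.mem_univ i), ← mul_assoc, ← hv,
          ← Finset.prod_update_of_mem (Finset.mem_univ i), Function.update_eq_self]
      · simp [← hv]
    calc _ ≤ _ := Finset.card_le_card hsub
      _ ≤ _ := Finset.card_image_le
      _ = d * (Nat.finMulAntidiag d a).card := by simp [Finset.card_product]
      _ ≤ d * d ^ Ω a := Nat.mul_le_mul_left _ (ih ha)
      _ = _ := by
        rw [ArithmeticFunction.cardFactors_mul hp.ne_zero ha,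
          ArithmeticFunction.cardFactors_apply_prime hp, pow_add, pow_one]

/-- Restricted to primes `p` with `x / p ≤ Y`, the weight of `x = p m` is `4 ^ (-Ω m) log p`,
summed over all such representations. -/
noncomputable def primeCofactorWeight (Y x : ℕ) : ℝ :=
  ∑ p ∈ x.primeFactors with x / p ≤ Y, quarterOmega (x / p) * Real.log p

lemma primeCofactorWeight_nonneg (Y x : ℕ) : 0 ≤ primeCofactorWeight Y x :=
  Finset.sum_nonneg fun p _ => mul_nonneg (quarterOmega_pos _).le (Real.log_natCast_nonneg p)

/-- Removing one prime multiplies `4 ^ (-Ω)` by `4`, and the logarithms of the distinct primes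
dividing `x` sum to at most `log x`. -/
lemma primeCofactorWeight_le (Y : ℕ) {x : ℕ} (hx : x ≠ 0) :
    primeCofactorWeight Y x ≤ 4 * quarterOmega x * Real.log x := by
  have h1 : primeCofactorWeight Y x ≤
      ∑ p ∈ x.primeFactors, quarterOmega (x / p) * Real.log p :=
    Finset.sum_le_sum_of_subset_of_nonneg (Finset.filter_subset _ _) fun p _ _ =>
      mul_nonneg (quarterOmega_pos _).le (Real.log_natCast_nonneg p)
  have h2 : ∀ p ∈ x.primeFactors,
      quarterOmega (x / p) * Real.log p = 4 * quarterOmega x * Real.log p := by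
    intro p hp
    have hpp := Nat.prime_of_mem_primeFactors hp
    obtain ⟨m, rfl⟩ := Nat.dvd_of_mem_primeFactors hp
    rw [Nat.mul_div_cancel_left _ hpp.pos, quarterOmega_mul hpp.ne_zero (right_ne_zero_of_mul hx),
      quarterOmega_prime hpp]
    ring
  rw [Finset.sum_congr rfl h2, ← Finset.mul_sum] at h1
  refine h1.trans ?_
  have := quarterOmega_pos x
  gcongr
  rw [← Real.log_prod (fun p hp => by
    exact_mod_cast (Nat.prime_of_mem_primeFactors hp).ne_zero)]
  have h3 := Nat.le_of_dvd (Nat.pos_of_ne_zero hx) (Nat.prod_primeFactors_dvd x)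
  apply Real.log_le_log
  · exact Finset.prod_pos fun p hp => by exact_mod_cast (Nat.prime_of_mem_primeFactors hp).pos
  · rw [← Nat.cast_prod]
    exact_mod_cast h3

/-- The logarithmic sum of `4 ^ (-Ω m)`. -/
noncomputable def quarterOmegaLogSum (Y : ℕ) : ℝ :=
  ∑ m ∈ Finset.Icc 1 Y, quarterOmega m / m

lemma sum_primeCofactorWeight (Y a b : ℕ) (hab : a ≤ b) :
    ∑ x ∈ Finset.Ioc a b, primeCofactorWeight Y x =
      ∑ m ∈ Finset.Icc 1 Y, quarterOmega m *
        (Chebyshev.theta ((b : ℝ) / m) - Chebyshev.theta ((a : ℝ) / m)) := by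
  have h1 : ∀ m ∈ Finset.Icc 1 Y, quarterOmega m *
        (Chebyshev.theta ((b : ℝ) / m) - Chebyshev.theta ((a : ℝ) / m)) =
      ∑ p ∈ Finset.Ioc (a / m) (b / m) with p.Prime, quarterOmega m * Real.log p := by
    intro m _
    rw [← Finset.mul_sum]
    congr 1
    rw [sub_eq_iff_eq_add]
    unfold Chebyshev.theta
    rw [Nat.floor_div_natCast, Nat.floor_div_natCast, Nat.floor_natCast, Nat.floor_natCast,
      add_comm, Finset.sum_filter, Finset.sum_filter, Finset.sum_filter,
      Finset.sum_Ioc_consecutive _ (Nat.zero_le _) (Nat.div_le_div_right hab)]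
  rw [Finset.sum_congr rfl h1]
  unfold primeCofactorWeight
  rw [Finset.sum_sigma', Finset.sum_sigma']
  refine Finset.sum_bij' (fun q _ => ⟨q.1 / q.2, q.2⟩) (fun q _ => ⟨q.1 * q.2, q.2⟩) ?_ ?_ ?_ ?_ ?_
  · rintro ⟨x, p⟩ h
    simp only [Finset.mem_sigma, Finset.mem_Ioc, Finset.mem_filter, Nat.mem_primeFactors,
      Finset.mem_Icc] at h ⊢
    obtain ⟨⟨h1, h2⟩, ⟨hp, ⟨m, rfl⟩, h3⟩, h4⟩ := h
    rw [Nat.mul_div_cancel_left _ hp.pos] at h4 ⊢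
    have hm : 0 < m := Nat.pos_of_ne_zero (right_ne_zero_of_mul h3)
    exact ⟨⟨hm, h4⟩, ⟨(Nat.div_lt_iff_lt_mul hm).2 h1, (Nat.le_div_iff_mul_le hm).2 h2⟩, hp⟩
  · rintro ⟨m, p⟩ h
    simp only [Finset.mem_sigma, Finset.mem_Ioc, Finset.mem_filter, Nat.mem_primeFactors,
      Finset.mem_Icc] at h ⊢
    obtain ⟨⟨hm, h4⟩, ⟨h1, h2⟩, hp⟩ := h
    rw [Nat.mul_div_cancel _ hp.pos]
    rw [Nat.div_lt_iff_lt_mul (by omega)] at h1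
    rw [Nat.le_div_iff_mul_le (by omega)] at h2
    refine ⟨⟨by rwa [mul_comm], by rwa [mul_comm]⟩, ⟨hp, dvd_mul_left _ _, ?_⟩, h4⟩
    exact mul_ne_zero (by omega) hp.ne_zero
  · rintro ⟨x, p⟩ h
    simp only [Finset.mem_sigma, Finset.mem_Ioc, Finset.mem_filter, Nat.mem_primeFactors] at h
    simp [Nat.div_mul_cancel h.2.1.2.1]
  · rintro ⟨m, p⟩ h
    simp only [Finset.mem_sigma, Finset.mem_Ioc, Finset.mem_filter] at h
    simp [Nat.mul_div_cancel _ h.2.2.pos]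
  · rintro ⟨x, p⟩ h
    rfl

/-! ### Chebyshev bounds and the size of the logarithmic sum -/

/-- The ratio `4` gives room for elementary bounds: `4 log 2 - log 4 = 2 log 2 > 1` absorbs the
error terms below, and `4 log 4 < 6` above. -/
lemma exists_theta_four_mul_sub_theta_bounds :
    ∃ X₀ : ℝ, ∀ X : ℝ, X₀ ≤ X →
      X ≤ Chebyshev.theta (4 * X) - Chebyshev.theta X ∧
        Chebyshev.theta (4 * X) - Chebyshev.theta X ≤ 6 * X := by
  have h4 : Real.log 4 = 2 * Real.log 2 := by
    rw [show (4 : ℝ) = 2 ^ 2 by norm_num, Real.log_pow]; norm_num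
  have hl1 := Real.log_two_gt_d9
  have hl2 := Real.log_two_lt_d9
  have ho : (fun x : ℝ => Real.log x) =o[atTop] fun x : ℝ => x ^ (1 / 4 : ℝ) :=
    isLittleO_log_rpow_atTop (by norm_num)
  have hb := ho.bound (c := 1) one_pos
  have hlarge : ∀ᶠ x : ℝ in atTop, (10000 : ℝ) ≤ x := eventually_ge_atTop _
  have hq : ∀ᶠ x : ℝ in atTop, (100 : ℝ) ≤ x ^ (1 / 4 : ℝ) :=
    (tendsto_rpow_atTop (by norm_num : (0 : ℝ) < 1 / 4)).eventually_ge_atTop _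
  obtain ⟨X₁, hX₁⟩ := eventually_atTop.1 (hb.and (hlarge.and hq))
  refine ⟨max X₁ 10000, fun X hX => ?_⟩
  have hX1 : X₁ ≤ X := (le_max_left _ _).trans hX
  have hX2 : (10000 : ℝ) ≤ X := (le_max_right _ _).trans hX
  constructor
  · obtain ⟨hb, -, hq⟩ := hX₁ (4 * X) (by linarith)
    have hup := Chebyshev.theta_le_log4_mul_x (x := X) (by linarith)
    have hlow := Chebyshev.theta_ge' (x := 4 * X) (by linarith)
    set Z := 4 * X with hZ
    have hZ0 : 0 < Z := by linarith
    set t := Z ^ (1 / 4 : ℝ) with ht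
    have ht4 : t ^ 4 = Z := by
      rw [ht, ← Real.rpow_natCast, ← Real.rpow_mul hZ0.le]; norm_num
    have hsq : √Z = t ^ 2 := by
      rw [← ht4, show t ^ 4 = (t ^ 2) ^ 2 by ring, Real.sqrt_sq (by positivity)]
    have hlog : Real.log Z ≤ t := by
      have := (Real.norm_eq_abs _ ▸ le_abs_self (Real.log Z)).trans hb
      rwa [one_mul, Real.norm_of_nonneg (by positivity)] at this
    have hlog2 : Real.log (Z + 2) ≤ 2 * t := by
      have : Real.log (Z + 2) ≤ Real.log (Z ^ 2) :=
        Real.log_le_log (by linarith) (by nlinarith)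
      rw [Real.log_pow] at this
      push_cast at this
      linarith
    rw [hsq] at hlow
    have h1 : 2 * t ^ 2 * Real.log Z ≤ 2 * t ^ 3 := by
      nlinarith [mul_le_mul_of_nonneg_left hlog (sq_nonneg t)]
    have h2 : 100 * t ^ 3 ≤ Z := by
      rw [← ht4]; nlinarith [pow_pos (by linarith : 0 < t) 3]
    have h3 : 10000 * t ≤ t ^ 3 := by nlinarith
    nlinarith
  · have hup := Chebyshev.theta_le_log4_mul_x (x := 4 * X) (by linarith)
    have := Chebyshev.theta_nonneg X
    nlinarith

lemma one_le_quarterOmegaLogSum {Y : ℕ} (hY : 1 ≤ Y) : 1 ≤ quarterOmegaLogSum Y := by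
  have := Finset.single_le_sum (f := fun m : ℕ => quarterOmega m / m) (s := Finset.Icc 1 Y)
    (fun m _ => div_nonneg (quarterOmega_pos m).le (Nat.cast_nonneg m))
    (Finset.mem_Icc.2 ⟨le_rfl, hY⟩)
  simpa [quarterOmega, quarterOmegaLogSum] using this

/-- Expand the fourth power over quadruples. A squarefree `n` has exactly `4 ^ Ω n` ordered
factorizations into four factors, each contributing `4 ^ (-Ω n) / n`. -/
lemma sum_squarefree_inv_le (Y : ℕ) :
    ∑ n ∈ Finset.Icc 1 Y with Squarefree n, (1 / n : ℝ) ≤ quarterOmegaLogSum Y ^ 4 := by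
  have h1 : quarterOmegaLogSum Y ^ 4 =
      ∑ u ∈ Fintype.piFinset fun _ : Fin 4 => Finset.Icc 1 Y,
        ∏ a, quarterOmega (u a) / (u a : ℝ) := by
    rw [← Finset.prod_univ_sum (fun _ => Finset.Icc 1 Y)
      (fun _ x => quarterOmega x / (x : ℝ))]
    simp [quarterOmegaLogSum]
  set V := (Finset.Icc 1 Y).filter Squarefree with hV
  have h2 : ∀ n ∈ V, (1 / n : ℝ) =
      ∑ u ∈ Nat.finMulAntidiag 4 n, ∏ a, quarterOmega (u a) / (u a : ℝ) := by
    intro n hn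
    have hn := (Finset.mem_filter.1 hn).2
    have : ∀ u ∈ Nat.finMulAntidiag 4 n, ∏ a, quarterOmega (u a) / (u a : ℝ) =
        quarterOmega n / n := by
      intro u hu
      rw [Finset.prod_div_distrib,
        ← quarterOmega_prod _ _ fun a _ => Nat.ne_zero_of_mem_finMulAntidiag hu a,
        ← Nat.cast_prod, Nat.prod_eq_of_mem_finMulAntidiag hu]
    rw [Finset.sum_congr rfl this, Finset.sum_const, Nat.card_finMulAntidiag_of_squarefree hn,
      quarterOmega, (ArithmeticFunction.cardDistinctFactors_eq_cardFactors_iff_squarefree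
        hn.ne_zero).2 hn, nsmul_eq_mul]
    push_cast
    rw [← mul_div_assoc, ← mul_pow]
    norm_num
  rw [h1, Finset.sum_congr rfl h2, Finset.sum_sigma']
  refine Finset.sum_le_sum_of_injOn_of_nonneg (fun q => q.2) ?_ ?_ (fun _ _ => le_rfl) ?_
  · rintro ⟨n, u⟩ h ⟨n', u'⟩ h' (rfl : u = u')
    simp only [Finset.coe_sigma, Set.mem_sigma_iff, Finset.mem_coe] at h h'
    obtain rfl : n = n' :=
      (Nat.prod_eq_of_mem_finMulAntidiag h.2).symm.trans (Nat.prod_eq_of_mem_finMulAntidiag h'.2)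
    rfl
  · rintro ⟨n, u⟩ h
    simp only [Finset.mem_sigma, hV, Finset.mem_filter, Finset.mem_Icc, Fintype.mem_piFinset] at h ⊢
    intro a
    exact ⟨Nat.pos_of_ne_zero (Nat.ne_zero_of_mem_finMulAntidiag h.2 a),
      (Nat.le_of_dvd h.1.1.1 (Nat.dvd_of_mem_finMulAntidiag h.2 a)).trans h.1.1.2⟩
  · intro u _
    exact Finset.prod_nonneg fun a _ => div_nonneg (quarterOmega_pos _).le (Nat.cast_nonneg _)

/-- Writing `n = b ^ 2 a` with `a` squarefree bounds the harmonic sum by the squarefree sum times `∑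
1 / b ^ 2 ≤ 2`. -/
lemma half_log_le_sum_squarefree_inv (Y : ℕ) :
    Real.log Y / 2 ≤ ∑ n ∈ Finset.Icc 1 Y with Squarefree n, (1 / n : ℝ) := by
  have h1 : Real.log Y ≤ ∑ n ∈ Finset.Icc 1 Y, (1 / n : ℝ) := by
    rcases Nat.eq_zero_or_pos Y with rfl | hY
    · simp
    · have := log_add_one_le_harmonic Y
      rw [harmonic_eq_sum_Icc] at this
      push_cast at this
      simp only [one_div]
      refine le_trans (Real.log_le_log (by exact_mod_cast hY) ?_) this
      linarith
  have hex : ∀ n : ℕ, ∃ q : ℕ × ℕ, 0 < n → 0 < q.1 ∧ 0 < q.2 ∧ q.2 ^ 2 * q.1 = n ∧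
      Squarefree q.1 := by
    intro n
    rcases Nat.eq_zero_or_pos n with rfl | hn
    · exact ⟨(0, 0), by simp⟩
    · obtain ⟨a, b, h⟩ := Nat.sq_mul_squarefree_of_pos hn
      exact ⟨(a, b), fun _ => h⟩
  choose g hg using hex
  have h2 : ∑ n ∈ Finset.Icc 1 Y, (1 / n : ℝ) ≤
      ∑ q ∈ (Finset.Icc 1 Y).filter Squarefree ×ˢ Finset.Icc 1 Y,
        (1 / q.1 : ℝ) * ((q.2 : ℝ) ^ 2)⁻¹ := by
    refine Finset.sum_le_sum_of_injOn_of_nonneg g ?_ ?_ ?_ ?_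
    · intro n hn n' hn' h
      have h1 := (hg n (Finset.mem_Icc.1 hn).1).2.2.1
      have h2 := (hg n' (Finset.mem_Icc.1 hn').1).2.2.1
      rw [← h1, ← h2, h]
    · intro n hn
      have hn := Finset.mem_Icc.1 hn
      obtain ⟨ha, hb, hab, hs⟩ := hg n hn.1
      simp only [Finset.mem_product, Finset.mem_filter, Finset.mem_Icc]
      exact ⟨⟨⟨ha, (Nat.le_of_dvd hn.1 ⟨(g n).2 ^ 2, by rw [mul_comm, hab]⟩).trans hn.2⟩, hs⟩, hb,
        (Nat.le_of_dvd hn.1 ⟨(g n).2 * (g n).1, by rw [← mul_assoc, ← sq, hab]⟩).trans hn.2⟩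
    · intro n hn
      obtain ⟨ha, hb, hab, hs⟩ := hg n (Finset.mem_Icc.1 hn).1
      conv_lhs => rw [← hab]
      push_cast
      rw [one_div, mul_inv, one_div, mul_comm]
    · intro q _
      positivity
  rw [Finset.sum_product] at h2
  simp only [← Finset.mul_sum] at h2
  rw [← Finset.sum_mul] at h2
  have h3 : ∑ b ∈ Finset.Icc 1 Y, ((b : ℝ) ^ 2)⁻¹ ≤ 2 := by
    have := sum_Ioo_inv_sq_le (α := ℝ) 0 (Y + 1)
    have he : Finset.Ioo 0 (Y + 1) = Finset.Icc 1 Y := by ext; simp; omega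
    rw [he] at this
    simpa using this
  have h4 : 0 ≤ ∑ n ∈ Finset.Icc 1 Y with Squarefree n, (1 / n : ℝ) :=
    Finset.sum_nonneg fun _ _ => by positivity
  nlinarith

lemma half_log_le_quarterOmegaLogSum_pow (Y : ℕ) :
    Real.log Y / 2 ≤ quarterOmegaLogSum Y ^ 4 :=
  (half_log_le_sum_squarefree_inv Y).trans (sum_squarefree_inv_le Y)

/-! ### Mass of the boxes -/

/-- The interval of numbers of logarithmic size `j` to the base `4`. -/
def scaleBox (j : ℕ) : Finset ℕ := Finset.Ioc (4 ^ j) (4 ^ (j + 1))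

/-- Chebyshev-type bounds for the total weight of a box well above `Y`. -/
lemma exists_sum_primeCofactorWeight_bounds :
    ∃ H : ℕ, ∀ h j : ℕ, H ≤ h → 3 * h ≤ j →
      4 ^ j * quarterOmegaLogSum (4 ^ h) ≤
          ∑ x ∈ scaleBox j, primeCofactorWeight (4 ^ h) x ∧
        ∑ x ∈ scaleBox j, primeCofactorWeight (4 ^ h) x ≤
          6 * (4 ^ j * quarterOmegaLogSum (4 ^ h)) := by
  obtain ⟨X₀, hX₀⟩ := exists_theta_four_mul_sub_theta_bounds
  obtain ⟨H, hH⟩ := exists_nat_ge X₀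
  refine ⟨H, fun h j hh hj => ?_⟩
  rw [scaleBox, sum_primeCofactorWeight _ _ _ (Nat.pow_le_pow_right (by norm_num) (Nat.le_succ j))]
  have key : ∀ m : ℕ, m ∈ Finset.Icc 1 (4 ^ h) → X₀ ≤ ((4 ^ j : ℕ) : ℝ) / m := by
    intro m hm
    obtain ⟨hm1, hm2⟩ := Finset.mem_Icc.1 hm
    have hm0 : (0 : ℝ) < m := by exact_mod_cast hm1
    rw [le_div_iff₀ hm0]
    have h1 : h * 4 ^ h ≤ 4 ^ j := calc
      h * 4 ^ h ≤ 4 ^ h * 4 ^ h := Nat.mul_le_mul_right _ (Nat.lt_pow_self (by norm_num)).le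
      _ = 4 ^ (h + h) := (pow_add _ _ _).symm
      _ ≤ 4 ^ j := Nat.pow_le_pow_right (by norm_num) (by omega)
    have h2 : X₀ ≤ h := hH.trans (by exact_mod_cast hh)
    calc X₀ * m ≤ h * m := by gcongr
      _ ≤ h * (4 ^ h : ℕ) := by gcongr
      _ ≤ _ := by exact_mod_cast h1
  have hcast : ∀ m : ℕ, ((4 ^ (j + 1) : ℕ) : ℝ) / m = 4 * (((4 ^ j : ℕ) : ℝ) / m) := by
    intro m; push_cast; ring
  have hsum : (4 : ℝ) ^ j * quarterOmegaLogSum (4 ^ h) =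
      ∑ m ∈ Finset.Icc 1 (4 ^ h), quarterOmega m * (((4 ^ j : ℕ) : ℝ) / m) := by
    unfold quarterOmegaLogSum
    rw [Finset.mul_sum]
    refine Finset.sum_congr rfl fun m _ => ?_
    push_cast; ring
  rw [hsum, Finset.mul_sum]
  constructor <;> refine Finset.sum_le_sum fun m hm => ?_ <;> rw [hcast]
  · exact mul_le_mul_of_nonneg_left (hX₀ _ (key m hm)).1 (quarterOmega_pos m).le
  · have := mul_le_mul_of_nonneg_left (hX₀ _ (key m hm)).2 (quarterOmega_pos m).le
    linarith

/-- Fubini for product weights. It will separate the four edges at a vertex, on which the condition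
depends, from the six free edges. -/
lemma sum_piFinset_prod_mul_comp {α β E : Type*} [Fintype α] [Fintype β] [Fintype E]
    [DecidableEq α] [DecidableEq β] [DecidableEq E] (σ : α ⊕ β ≃ E) (B : E → Finset ℕ)
    (w : ℕ → ℝ) (g : (α → ℕ) → ℝ) :
    ∑ z ∈ Fintype.piFinset B, (∏ e, w (z e)) * g (fun a => z (σ (Sum.inl a))) =
      (∑ u ∈ Fintype.piFinset fun a => B (σ (Sum.inl a)), (∏ a, w (u a)) * g u) *
        ∏ b, ∑ x ∈ B (σ (Sum.inr b)), w x := by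
  rw [Finset.prod_univ_sum (fun b => B (σ (Sum.inr b))) (fun _ x => w x), Finset.sum_mul_sum,
    ← Finset.sum_product']
  refine Finset.sum_bij' (fun z _ => (fun a => z (σ (Sum.inl a)), fun b => z (σ (Sum.inr b))))
    (fun q _ e => Sum.elim q.1 q.2 (σ.symm e)) ?_ ?_ ?_ ?_ ?_
  · intro z hz
    rw [Fintype.mem_piFinset] at hz
    simp [Fintype.mem_piFinset, hz]
  · rintro ⟨u, v⟩ h
    simp only [Finset.mem_product, Fintype.mem_piFinset] at h ⊢
    intro e
    obtain ⟨c, rfl⟩ := σ.surjective e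
    rcases c with a | b
    · simpa using h.1 a
    · simpa using h.2 b
  · intro z _
    funext e
    obtain ⟨c, rfl⟩ := σ.surjective e
    rcases c with a | b <;> simp
  · rintro ⟨u, v⟩ _
    simp
  · intro z _
    rw [← Equiv.prod_comp σ, Fintype.prod_sum_type]
    ring

/-! ### Edge labellings of the complete graph on five vertices -/

/-! The edges of the complete graph on `Fin 5` are indexed by `Fin 5 ⊕ Fin 5`: the side `inl i`
joins `i` and `i + 1`, and the diagonal `inr i` joins `i - 1` and `i + 1`. -/

/-- The four edges at the vertex `i`. -/
def incidentEdge (i : Fin 5) : Fin 4 → Fin 5 ⊕ Fin 5 :=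
  ![Sum.inl i, Sum.inl (i + 4), Sum.inr (i + 1), Sum.inr (i + 4)]

/-- The six edges that avoid the vertex `i`. -/
def avoidingEdge (i : Fin 5) : Fin 6 → Fin 5 ⊕ Fin 5 :=
  ![Sum.inl (i + 1), Sum.inl (i + 2), Sum.inl (i + 3), Sum.inr i, Sum.inr (i + 2), Sum.inr (i + 3)]

lemma bijective_incidentEdge_avoidingEdge (i : Fin 5) :
    Function.Bijective (Sum.elim (incidentEdge i) (avoidingEdge i)) := by
  rw [Fintype.bijective_iff_injective_and_card]
  refine ⟨?_, by simp⟩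
  revert i
  decide

/-- The edges of the complete graph on `Fin 5`, split by incidence with `i`. -/
noncomputable def edgeSplit (i : Fin 5) : Fin 4 ⊕ Fin 6 ≃ Fin 5 ⊕ Fin 5 :=
  Equiv.ofBijective _ (bijective_incidentEdge_avoidingEdge i)

@[simp] lemma edgeSplit_inl (i : Fin 5) (a : Fin 4) :
    edgeSplit i (Sum.inl a) = incidentEdge i a := rfl

@[simp] lemma edgeSplit_inr (i : Fin 5) (b : Fin 6) :
    edgeSplit i (Sum.inr b) = avoidingEdge i b := rfl

/-- The product of the edge labels at the vertex `i`. -/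
def vertexProd (z : Fin 5 ⊕ Fin 5 → ℕ) (i : Fin 5) : ℕ := ∏ a, z (incidentEdge i a)

lemma prod_vertexProd (z : Fin 5 ⊕ Fin 5 → ℕ) : ∏ i, vertexProd z i = (∏ e, z e) * ∏ e, z e := by
  simp [vertexProd, incidentEdge, Fin.prod_univ_succ, Fintype.prod_sum_type]
  ring

/-- Logarithmic sizes of the ten edge labels, in terms of those of the five diagonals. -/
def edgeScale (h : ℕ) (d : Fin 5 → ℕ) : Fin 5 ⊕ Fin 5 → ℕ :=
  Sum.elim (fun i => 10 * h + 4 * i + d (i + 3) - d (i + 4) - d (i + 2)) d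

/-- Logarithmic size of the vertex product at `i`. -/
def vertexScale (h : ℕ) (i : Fin 5) : ℕ := 20 * h + 4 * (![4, 1, 3, 5, 7] : Fin 5 → ℕ) i

/-- The admissible diagonal scales. -/
def diagonalScales (h : ℕ) : Finset (Fin 5 → ℕ) :=
  Fintype.piFinset fun _ => Finset.Ico (5 * h) (6 * h)

lemma mem_diagonalScales {h : ℕ} {d : Fin 5 → ℕ} :
    d ∈ diagonalScales h ↔ ∀ i, 5 * h ≤ d i ∧ d i < 6 * h := by
  simp [diagonalScales, Fintype.mem_piFinset]

lemma three_mul_le_edgeScale {h : ℕ} {d : Fin 5 → ℕ} (hd : d ∈ diagonalScales h)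
    (e : Fin 5 ⊕ Fin 5) : 3 * h ≤ edgeScale h d e := by
  rw [mem_diagonalScales] at hd
  rcases e with i | i
  · have h1 := hd (i + 3)
    have h2 := hd (i + 4)
    have h3 := hd (i + 2)
    simp only [edgeScale, Sum.elim_inl]
    omega
  · have := hd i
    simp only [edgeScale, Sum.elim_inr]
    omega

/-- The side scales are built so that the diagonal parameters cancel at every vertex. The offsets `4
* i` leave the distinct values `4, 1, 3, 5, 7` (times `4`), sums of the indices of the two sides at
the vertex. Subtraction never truncates, since `15 h - 12 h ≥ 0`. -/
lemma sum_edgeScale_incidentEdge {h : ℕ} {d : Fin 5 → ℕ} (hd : d ∈ diagonalScales h)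
    (i : Fin 5) : ∑ a, edgeScale h d (incidentEdge i a) = vertexScale h i := by
  rw [mem_diagonalScales] at hd
  have h0 := hd 0
  have h1 := hd 1
  have h2 := hd 2
  have h3 := hd 3
  have h4 := hd 4
  fin_cases i <;>
    simp [incidentEdge, edgeScale, vertexScale, Fin.sum_univ_four] <;> omega

lemma sum_edgeScale_avoidingEdge_le {h : ℕ} {d : Fin 5 → ℕ} (hd : d ∈ diagonalScales h)
    (i : Fin 5) : ∑ b, edgeScale h d (avoidingEdge i b) ≤ 30 * h + 40 := by
  rw [mem_diagonalScales] at hd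
  have h0 := hd 0
  have h1 := hd 1
  have h2 := hd 2
  have h3 := hd 3
  have h4 := hd 4
  fin_cases i <;>
    simp [avoidingEdge, edgeScale, Fin.sum_univ_six] <;> omega

lemma sum_edgeScale {h : ℕ} {d : Fin 5 → ℕ} (hd : d ∈ diagonalScales h) :
    ∑ e, edgeScale h d e = 50 * h + 40 := by
  rw [mem_diagonalScales] at hd
  have h0 := hd 0
  have h1 := hd 1
  have h2 := hd 2
  have h3 := hd 3
  have h4 := hd 4
  simp [edgeScale, Fintype.sum_sum_type, Fin.sum_univ_five]
  omega

lemma eq_of_mem_scaleBox {x j k : ℕ} (hj : x ∈ scaleBox j) (hk : x ∈ scaleBox k) : j = k := by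
  simp only [scaleBox, Finset.mem_Ioc] at hj hk
  have h1 := (Nat.pow_lt_pow_iff_right (by norm_num : 1 < 4)).1 (hj.1.trans_le hk.2)
  have h2 := (Nat.pow_lt_pow_iff_right (by norm_num : 1 < 4)).1 (hk.1.trans_le hj.2)
  omega

/-- The labels at `i` determine `d (i + 1)`, `d (i + 4)` and, through a side, `d (i + 3) - d (i +
2)`. The second side repeats this relation because the vertex scale is fixed, so `d i` and `d (i +
2)` remain free. -/
lemma card_filter_diagonalScales_le (h : ℕ) (i : Fin 5) (u : Fin 4 → ℕ) :
    ((diagonalScales h).filter fun d => ∀ a, u a ∈ scaleBox (edgeScale h d (incidentEdge i a))).card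
      ≤ h ^ 2 := by
  have hcard : (Finset.Ico (5 * h) (6 * h) ×ˢ Finset.Ico (5 * h) (6 * h)).card = h ^ 2 := by
    rw [Finset.card_product, Nat.card_Ico, ← Nat.sub_mul]; ring
  rw [← hcard]
  refine Finset.card_le_card_of_injOn (fun d => (d i, d (i + 2))) ?_ ?_
  · intro d hd
    have hd := mem_diagonalScales.1 (Finset.mem_filter.1 hd).1
    simpa using ⟨hd i, hd (i + 2)⟩
  · intro d hd d' hd' heq
    obtain ⟨hd, hu⟩ := Finset.mem_filter.1 hd
    obtain ⟨hd', hu'⟩ := Finset.mem_filter.1 hd'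
    have hs := fun a => eq_of_mem_scaleBox (hu a) (hu' a)
    have s0 := hs 0
    have s2 := hs 2
    have s3 := hs 3
    rw [mem_diagonalScales] at hd hd'
    simp only [Prod.mk.injEq] at heq
    obtain ⟨e0, e2⟩ := heq
    simp only [incidentEdge, edgeScale, Matrix.cons_val, Sum.elim_inl, Sum.elim_inr] at s0 s2 s3
    have e3 : d (i + 3) = d' (i + 3) := by
      have h1 := hd (i + 3)
      have h2 := hd (i + 4)
      have h3 := hd (i + 2)
      have h1' := hd' (i + 3)
      omega
    funext k
    have hk : k = i ∨ k = i + 1 ∨ k = i + 2 ∨ k = i + 3 ∨ k = i + 4 := by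
      clear * -
      revert i k; decide
    rcases hk with rfl | rfl | rfl | rfl | rfl <;> assumption

lemma vertexProd_mem {h : ℕ} {d : Fin 5 → ℕ} (hd : d ∈ diagonalScales h)
    {z : Fin 5 ⊕ Fin 5 → ℕ} (hz : ∀ e, z e ∈ scaleBox (edgeScale h d e)) (i : Fin 5) :
    4 ^ vertexScale h i < vertexProd z i ∧ vertexProd z i ≤ 4 ^ (vertexScale h i + 4) := by
  simp only [scaleBox, Finset.mem_Ioc] at hz
  have hs := sum_edgeScale_incidentEdge hd i
  constructor
  · rw [← hs, ← Finset.prod_pow_eq_pow_sum]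
    exact Finset.prod_lt_prod_of_nonempty (fun a _ => by positivity) (fun a _ => (hz _).1)
      Finset.univ_nonempty
  · have : 4 ^ (vertexScale h i + 4) = ∏ a, 4 ^ (edgeScale h d (incidentEdge i a) + 1) := by
      rw [Finset.prod_pow_eq_pow_sum, Finset.sum_add_distrib, hs]
      simp
    rw [this]
    exact Finset.prod_le_prod' fun a _ => (hz _).2

/-- The four half-open boxes at a vertex confine its product to `(4 ^ s, 4 ^ (s + 4)]`, and the
vertex scales `s` differ by at least `4`, so these intervals are disjoint. -/
lemma vertexProd_injective {h : ℕ} {d : Fin 5 → ℕ} (hd : d ∈ diagonalScales h)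
    {z : Fin 5 ⊕ Fin 5 → ℕ} (hz : ∀ e, z e ∈ scaleBox (edgeScale h d e)) :
    Function.Injective (vertexProd z) := by
  intro i k hik
  have h1 := vertexProd_mem hd hz i
  have h2 := vertexProd_mem hd hz k
  rw [hik] at h1
  have h3 := (Nat.pow_lt_pow_iff_right (by norm_num : 1 < 4)).1 (h1.1.trans_le h2.2)
  have h4 := (Nat.pow_lt_pow_iff_right (by norm_num : 1 < 4)).1 (h2.1.trans_le h1.2)
  simp only [vertexScale] at h3 h4
  have : (![4, 1, 3, 5, 7] : Fin 5 → ℕ) i = (![4, 1, 3, 5, 7] : Fin 5 → ℕ) k := by omega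
  clear h1 h2 h3 h4 hik
  revert i k
  decide

lemma exists_vertexProd_notMem {h N : ℕ} (hN : 4 ^ (20 * h + 32) ≤ N) {A : Finset ℕ}
    (hA : SquareProductFree 5 A) {d : Fin 5 → ℕ} (hd : d ∈ diagonalScales h)
    {z : Fin 5 ⊕ Fin 5 → ℕ} (hz : ∀ e, z e ∈ scaleBox (edgeScale h d e)) :
    ∃ i, vertexProd z i ∈ Finset.Icc 1 N \ A := by
  have hinj := vertexProd_injective hd hz
  by_contra! hcon
  refine hA (Finset.univ.image (vertexProd z)) ?_ ?_ ?_
  · intro n hn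
    obtain ⟨i, -, rfl⟩ := Finset.mem_image.1 hn
    have h1 := vertexProd_mem hd hz i
    by_contra hnA
    refine hcon i (Finset.mem_sdiff.2 ⟨Finset.mem_Icc.2 ⟨Nat.one_le_of_lt h1.1, h1.2.trans ?_⟩, hnA⟩)
    refine le_trans (Nat.pow_le_pow_right (by norm_num) ?_) hN
    fin_cases i <;> simp [vertexScale]
  · rw [Finset.card_image_of_injective _ hinj]; simp
  · rw [Finset.prod_image fun i _ k _ hik => hinj hik, prod_vertexProd]
    exact ⟨_, rfl⟩

/-! ### Double counting of weighted labellings -/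

lemma sum_finMulAntidiag_prod_le {w : ℕ → ℝ} (hw0 : ∀ x, 0 ≤ w x)
    (hw : ∀ x, x ≠ 0 → w x ≤ 4 * quarterOmega x * Real.log x) {n N : ℕ} (hn : n ≠ 0)
    (hnN : n ≤ N) :
    ∑ u ∈ Nat.finMulAntidiag 4 n, ∏ a, w (u a) ≤ (4 * Real.log N) ^ 4 := by
  have hq := quarterOmega_pos n
  have h1 : ∀ u ∈ Nat.finMulAntidiag 4 n,
      ∏ a, w (u a) ≤ (4 * Real.log N) ^ 4 * quarterOmega n := by
    intro u hu
    have hu0 := fun a => Nat.ne_zero_of_mem_finMulAntidiag hu a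
    have h2 : ∀ a, w (u a) ≤ 4 * Real.log N * quarterOmega (u a) := by
      intro a
      have hle : Real.log (u a) ≤ Real.log N := Real.log_le_log
        (by exact_mod_cast Nat.pos_of_ne_zero (hu0 a))
        (by exact_mod_cast (Nat.le_of_dvd (Nat.pos_of_ne_zero hn)
          (Nat.dvd_of_mem_finMulAntidiag hu a)).trans hnN)
      have := mul_le_mul_of_nonneg_left hle (quarterOmega_pos (u a)).le
      linarith [hw _ (hu0 a)]
    calc ∏ a, w (u a) ≤ ∏ a, (4 * Real.log N * quarterOmega (u a)) :=
          Finset.prod_le_prod (fun a _ => hw0 _) fun a _ => h2 a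
      _ = _ := by
        rw [Finset.prod_mul_distrib, ← quarterOmega_prod _ _ fun a _ => hu0 a,
          Nat.prod_eq_of_mem_finMulAntidiag hu]
        simp
  refine (Finset.sum_le_card_nsmul _ _ _ h1).trans ?_
  rw [nsmul_eq_mul]
  have hc : ((Nat.finMulAntidiag 4 n).card : ℝ) * quarterOmega n ≤ 1 := by
    have h3 : ((Nat.finMulAntidiag 4 n).card : ℝ) ≤ 4 ^ Ω n := by
      exact_mod_cast card_finMulAntidiag_le 4 hn
    calc _ ≤ 4 ^ Ω n * quarterOmega n := by gcongr
      _ = 1 := by rw [quarterOmega, ← mul_pow]; norm_num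
  calc _ = (4 * Real.log N) ^ 4 * (((Nat.finMulAntidiag 4 n).card : ℝ) * quarterOmega n) := by ring
    _ ≤ (4 * Real.log N) ^ 4 * 1 := by gcongr
    _ = _ := mul_one _

/-- The total weight of the edge labellings whose product at the vertex `i` lies in `S`. -/
lemma sum_prod_vertexProd_mem_le {w : ℕ → ℝ} (hw0 : ∀ x, 0 ≤ w x)
    (hw : ∀ x, x ≠ 0 → w x ≤ 4 * quarterOmega x * Real.log x) {h N : ℕ} {F : ℝ}
    (hbox : ∀ j, 3 * h ≤ j → ∑ x ∈ scaleBox j, w x ≤ 6 * (4 ^ j * F))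
    {S : Finset ℕ} (hS : S ⊆ Finset.Icc 1 N) (i : Fin 5) :
    ∑ d ∈ diagonalScales h, ∑ z ∈ Fintype.piFinset fun e => scaleBox (edgeScale h d e),
        (∏ e, w (z e)) * (if vertexProd z i ∈ S then 1 else 0) ≤
      (6 * F) ^ 6 * 4 ^ (30 * h + 40) * (h ^ 2 * (S.card * (4 * Real.log N) ^ 4)) := by
  set K : ℝ := (6 * F) ^ 6 * 4 ^ (30 * h + 40) with hK
  set P : (Fin 5 → ℕ) → Finset (Fin 4 → ℕ) := fun d =>
    Fintype.piFinset fun a => scaleBox (edgeScale h d (incidentEdge i a)) with hP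
  have hprod0 : ∀ u : Fin 4 → ℕ, 0 ≤ ∏ a, w (u a) := fun u => Finset.prod_nonneg fun a _ => hw0 _
  have h1 : ∀ d ∈ diagonalScales h,
      ∑ z ∈ Fintype.piFinset fun e => scaleBox (edgeScale h d e),
        (∏ e, w (z e)) * (if vertexProd z i ∈ S then 1 else 0) ≤
      K * ∑ n ∈ S, ∑ u ∈ Nat.finMulAntidiag 4 n, if u ∈ P d then ∏ a, w (u a) else 0 := by
    intro d hd
    have hsplit := sum_piFinset_prod_mul_comp (edgeSplit i) (fun e => scaleBox (edgeScale h d e)) w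
      (fun u => if ∏ a, u a ∈ S then 1 else 0)
    simp only [edgeSplit_inl, edgeSplit_inr] at hsplit
    have hrest : ∏ b, ∑ x ∈ scaleBox (edgeScale h d (avoidingEdge i b)), w x ≤ K := by
      calc _ ≤ ∏ b, (6 * F) * (4 : ℝ) ^ edgeScale h d (avoidingEdge i b) :=
            Finset.prod_le_prod (fun b _ => Finset.sum_nonneg fun x _ => hw0 x) fun b _ =>
              (hbox _ (three_mul_le_edgeScale hd _)).trans_eq (by ring)
        _ = (6 * F) ^ 6 * 4 ^ ∑ b, edgeScale h d (avoidingEdge i b) := by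
            rw [Finset.prod_mul_distrib, Finset.prod_pow_eq_pow_sum]; simp
        _ ≤ K := by
            rw [hK]
            gcongr
            · norm_num
            · exact sum_edgeScale_avoidingEdge_le hd i
    have hmain : ∑ u ∈ P d, (∏ a, w (u a)) * (if ∏ a, u a ∈ S then (1 : ℝ) else 0) =
        ∑ n ∈ S, ∑ u ∈ Nat.finMulAntidiag 4 n, if u ∈ P d then ∏ a, w (u a) else 0 := by
      simp only [mul_ite, mul_one, mul_zero]
      rw [← Finset.sum_filter, ← Finset.sum_fiberwise_of_maps_to (t := S)
        (g := fun u : Fin 4 → ℕ => ∏ a, u a) (fun u hu => (Finset.mem_filter.1 hu).2)]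
      refine Finset.sum_congr rfl fun n hn => ?_
      rw [← Finset.sum_filter]
      refine Finset.sum_congr ?_ fun _ _ => rfl
      ext u
      have hn0 : n ≠ 0 := by have := Finset.mem_Icc.1 (hS hn); omega
      simp only [Finset.mem_filter, Nat.mem_finMulAntidiag]
      constructor
      · rintro ⟨⟨h1, -⟩, h2⟩; exact ⟨⟨h2, hn0⟩, h1⟩
      · rintro ⟨⟨h2, -⟩, h1⟩; exact ⟨⟨h1, h2 ▸ hn⟩, h2⟩
    have hnn : 0 ≤ ∑ u ∈ P d, (∏ a, w (u a)) * (if ∏ a, u a ∈ S then (1 : ℝ) else 0) :=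
      Finset.sum_nonneg fun u _ => mul_nonneg (hprod0 u) (by split_ifs <;> norm_num)
    calc _ = _ := hsplit
      _ ≤ _ := mul_le_mul_of_nonneg_left hrest hnn
      _ = _ := by rw [hmain, mul_comm]
  refine (Finset.sum_le_sum h1).trans ?_
  rw [← Finset.mul_sum]
  refine mul_le_mul_of_nonneg_left ?_ (by positivity)
  -- Putting the scales innermost lets each factorization `u` be counted for at most `h ^ 2` of the
  -- `h ^ 5` choices of `d`.
  rw [Finset.sum_comm]
  have h2 : ∀ n ∈ S, ∑ d ∈ diagonalScales h, ∑ u ∈ Nat.finMulAntidiag 4 n,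
      (if u ∈ P d then ∏ a, w (u a) else 0) ≤ h ^ 2 * (4 * Real.log N) ^ 4 := by
    intro n hn
    have hn := Finset.mem_Icc.1 (hS hn)
    rw [Finset.sum_comm]
    calc _ ≤ ∑ u ∈ Nat.finMulAntidiag 4 n, (h : ℝ) ^ 2 * ∏ a, w (u a) := by
          refine Finset.sum_le_sum fun u _ => ?_
          rw [← Finset.sum_filter, Finset.sum_const, nsmul_eq_mul]
          refine mul_le_mul_of_nonneg_right ?_ (hprod0 u)
          have := card_filter_diagonalScales_le h i u
          simp only [hP, Fintype.mem_piFinset]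
          exact_mod_cast this
      _ ≤ _ := by
          rw [← Finset.mul_sum]
          exact mul_le_mul_of_nonneg_left
            (sum_finMulAntidiag_prod_le hw0 hw (by omega) hn.2) (by positivity)
  refine (Finset.sum_le_card_nsmul _ _ _ h2).trans_eq ?_
  rw [nsmul_eq_mul]
  ring

lemma SquareProductFree.mass_le {A : Finset ℕ} (hA : SquareProductFree 5 A) {w : ℕ → ℝ}
    (hw0 : ∀ x, 0 ≤ w x) (hw : ∀ x, x ≠ 0 → w x ≤ 4 * quarterOmega x * Real.log x)
    {h N : ℕ} {F : ℝ} (hF : 0 ≤ F) (hN : 4 ^ (20 * h + 32) ≤ N)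
    (hlow : ∀ j, 3 * h ≤ j → 4 ^ j * F ≤ ∑ x ∈ scaleBox j, w x)
    (hbox : ∀ j, 3 * h ≤ j → ∑ x ∈ scaleBox j, w x ≤ 6 * (4 ^ j * F)) :
    (h : ℝ) ^ 5 * (4 ^ (50 * h + 40) * F ^ 10) ≤
      5 * ((6 * F) ^ 6 * 4 ^ (30 * h + 40) *
        (h ^ 2 * ((Finset.Icc 1 N \ A).card * (4 * Real.log N) ^ 4))) := by
  set S := Finset.Icc 1 N \ A with hS
  have hcard : (diagonalScales h).card = h ^ 5 := by
    simp [diagonalScales, Fintype.card_piFinset, ← Nat.sub_mul]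
  calc (h : ℝ) ^ 5 * (4 ^ (50 * h + 40) * F ^ 10)
      = ∑ d ∈ diagonalScales h, (4 : ℝ) ^ (50 * h + 40) * F ^ 10 := by
        rw [Finset.sum_const, hcard, nsmul_eq_mul]; push_cast; rfl
    _ ≤ ∑ d ∈ diagonalScales h, ∏ e, ∑ x ∈ scaleBox (edgeScale h d e), w x := by
        refine Finset.sum_le_sum fun d hd => ?_
        calc _ = ∏ e, (4 : ℝ) ^ edgeScale h d e * F := by
              rw [Finset.prod_mul_distrib, Finset.prod_pow_eq_pow_sum, sum_edgeScale hd]; simp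
          _ ≤ _ := Finset.prod_le_prod (fun e _ => by positivity) fun e _ =>
              hlow _ (three_mul_le_edgeScale hd e)
    _ ≤ ∑ d ∈ diagonalScales h, ∑ z ∈ Fintype.piFinset fun e => scaleBox (edgeScale h d e),
          ∑ i, (∏ e, w (z e)) * (if vertexProd z i ∈ S then 1 else 0) := by
        refine Finset.sum_le_sum fun d hd => ?_
        rw [Finset.prod_univ_sum (fun e => scaleBox (edgeScale h d e)) (fun _ x => w x)]
        refine Finset.sum_le_sum fun z hz => ?_
        have hp : 0 ≤ ∏ e, w (z e) := Finset.prod_nonneg fun e _ => hw0 _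
        obtain ⟨i, hi⟩ := exists_vertexProd_notMem hN hA hd (Fintype.mem_piFinset.1 hz)
        refine le_trans ?_ (Finset.single_le_sum (fun k _ => mul_nonneg hp
          (by split_ifs <;> norm_num)) (Finset.mem_univ i))
        rw [if_pos hi, mul_one]
    _ = ∑ i : Fin 5, ∑ d ∈ diagonalScales h,
          ∑ z ∈ Fintype.piFinset fun e => scaleBox (edgeScale h d e),
            (∏ e, w (z e)) * (if vertexProd z i ∈ S then 1 else 0) := by
        rw [Finset.sum_comm]
        exact Finset.sum_congr rfl fun d _ => Finset.sum_comm
    _ ≤ _ := by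
        refine (Finset.sum_le_card_nsmul _ _ _ fun i _ =>
          sum_prod_vertexProd_mem_le hw0 hw hbox Finset.sdiff_subset i).trans_eq ?_
        rw [Finset.card_univ, Fintype.card_fin, nsmul_eq_mul, Nat.cast_ofNat]

/-! ### Positive defect for five elements -/

/-- For large `N`, a subset of `{1, …, N}` without `k` distinct elements whose product is a square
misses a positive proportion of `{1, …, N}`. -/
def HasSquareProductDefect (k : ℕ) : Prop :=
  ∃ c : ℝ, 0 < c ∧ ∃ N₀ : ℕ, ∀ N ≥ N₀, ∀ A ⊆ Finset.Icc 1 N, SquareProductFree k A →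
    c * N ≤ (Finset.Icc 1 N \ A).card

lemma log_four_bounds : 1 ≤ Real.log 4 ∧ Real.log 4 ≤ 7 / 5 := by
  rw [show (4 : ℝ) = 2 ^ 2 by norm_num, Real.log_pow]
  have hl1 := Real.log_two_gt_d9
  have hl2 := Real.log_two_lt_d9
  constructor <;> push_cast <;> linarith

lemma four_mul_log_le {h x : ℝ} (hh : 1 ≤ h) (hx : x ≤ (20 * h + 52) * Real.log 4) :
    4 * x ≤ 404 * h := by
  have := mul_le_mul_of_nonneg_left log_four_bounds.2 (by linarith : 0 ≤ 20 * h + 52)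
  linarith

/-- Both sides carry `h ^ 6 F ^ 6 P`: on the left `F ^ 4` supplies the sixth `h`, on the right `L ^
4` supplies `h ^ 4`. -/
lemma le_of_mass_le {h F P Q b L : ℝ} (hh : 0 < h) (hF : 0 < F) (hP : 0 < P) (hQ : 0 ≤ Q)
    (hb : 0 ≤ b) (hL : 0 ≤ L) (hLh : L ≤ 404 * h) (hF4 : h / 2 ≤ F ^ 4)
    (hmass : h ^ 5 * (Q * P * F ^ 10) ≤ 5 * ((6 * F) ^ 6 * P * (h ^ 2 * (b * L ^ 4)))) :
    Q ≤ 2 * (5 * 6 ^ 6 * 404 ^ 4) * b := by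
  have h1 : (h ^ 6 * F ^ 6 * P / 2) * Q ≤
      (h ^ 6 * F ^ 6 * P / 2) * (2 * (5 * 6 ^ 6 * 404 ^ 4) * b) := by
    calc _ = h ^ 5 * (Q * P * (F ^ 6 * (h / 2))) := by ring
      _ ≤ h ^ 5 * (Q * P * (F ^ 6 * F ^ 4)) := by gcongr
      _ = h ^ 5 * (Q * P * F ^ 10) := by ring
      _ ≤ _ := hmass
      _ ≤ 5 * ((6 * F) ^ 6 * P * (h ^ 2 * (b * (404 * h) ^ 4))) := by gcongr
      _ = _ := by ring
  exact le_of_mul_le_mul_left h1 (by positivity)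

lemma hasSquareProductDefect_five : HasSquareProductDefect 5 := by
  obtain ⟨H, hH⟩ := exists_sum_primeCofactorWeight_bounds
  set C : ℝ := 5 * 6 ^ 6 * 404 ^ 4
  refine ⟨1 / (2 * C * 4 ^ 52), by positivity, 4 ^ (20 * (H + 1) + 52), fun N hN A _ hA => ?_⟩
  have hN0 : N ≠ 0 := (lt_of_lt_of_le (by positivity) hN).ne'
  -- The largest `h` for which all vertex products, at most `4 ^ (20 * h + 28 + 4)`, fit below `N`.
  obtain ⟨h, hlog⟩ : ∃ h, h = (Nat.log 4 N - 32) / 20 := ⟨_, rfl⟩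
  have hlogN : 20 * (H + 1) + 52 ≤ Nat.log 4 N := Nat.le_log_of_pow_le (by norm_num) hN
  have hh : H + 1 ≤ h := by omega
  have hNlow : 4 ^ (20 * h + 32) ≤ N :=
    (Nat.pow_le_pow_right (by norm_num) (by omega)).trans (Nat.pow_log_le_self 4 hN0)
  have hNup : N ≤ 4 ^ (20 * h + 52) :=
    (Nat.lt_pow_succ_log_self (by norm_num) N).le.trans
      (Nat.pow_le_pow_right (by norm_num) (by omega))
  have hNup' : (N : ℝ) ≤ 4 ^ (20 * h + 52) := by exact_mod_cast hNup
  have hh1 : (1 : ℝ) ≤ h := by exact_mod_cast (by omega : 1 ≤ h)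
  set F := quarterOmegaLogSum (4 ^ h) with hF
  have hFpos : 0 < F := lt_of_lt_of_le one_pos 
    (one_le_quarterOmegaLogSum (Nat.one_le_pow _ _ (by norm_num)))
  have hF4 : (h : ℝ) / 2 ≤ F ^ 4 := by
    have hlogF := half_log_le_quarterOmegaLogSum_pow (4 ^ h)
    rw [← hF, Nat.cast_pow, Real.log_pow, Nat.cast_ofNat] at hlogF
    refine le_trans ?_ hlogF
    gcongr
    exact le_mul_of_one_le_right (Nat.cast_nonneg h) log_four_bounds.1
  have hmass := hA.mass_le (w := primeCofactorWeight (4 ^ h)) (F := F)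
    (primeCofactorWeight_nonneg (4 ^ h))
    (fun x hx => primeCofactorWeight_le (4 ^ h) hx) hFpos.le hNlow
    (fun j hj => (hH h j (by omega) hj).1) (fun j hj => (hH h j (by omega) hj).2)
  set b : ℝ := ((Finset.Icc 1 N \ A).card : ℝ) with hb
  have hb0 : 0 ≤ b := Nat.cast_nonneg _
  have hlogle : 4 * Real.log N ≤ 404 * h := by
    have h1 : Real.log N ≤ Real.log (4 ^ (20 * h + 52)) :=
      Real.log_le_log (by exact_mod_cast Nat.pos_of_ne_zero hN0) hNup'
    rw [Real.log_pow] at h1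
    push_cast at h1
    exact four_mul_log_le hh1 h1
  have hlog0 : 0 ≤ 4 * Real.log N := mul_nonneg zero_le_four (Real.log_natCast_nonneg N)
  rw [show 50 * h + 40 = 20 * h + (30 * h + 40) by ring, pow_add (4 : ℝ) (20 * h)] at hmass
  have h4 : (4 : ℝ) ^ (20 * h) ≤ 2 * C * b :=
    le_of_mass_le (lt_of_lt_of_le one_pos hh1) hFpos (by positivity) (by positivity) hb0 hlog0
      hlogle hF4 hmass
  rw [one_div_mul_eq_div, div_le_iff₀ (by positivity)]
  calc (N : ℝ) ≤ 4 ^ (20 * h) * 4 ^ 52 := by rw [← pow_add]; exact hNup'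
    _ ≤ 2 * C * b * 4 ^ 52 := by gcongr
    _ = _ := by ring

/-! ### Passage to all `k ≥ 4` -/

/-- Vacuous, since the empty product is a square. It starts the induction over even `k`. -/
lemma hasSquareProductDefect_zero : HasSquareProductDefect 0 :=
  ⟨1, one_pos, 0, fun _ _ _ _ hA => (hA ∅ (Finset.empty_subset _) rfl (by simp)).elim⟩

/-- Each missing element spoils at most two values `b ≤ N / 4`, once as `b` and once as `4 * b`. -/
lemma exists_mem_four_mul_mem {N : ℕ} {A : Finset ℕ}
    (hA : 2 * (Finset.Icc 1 N \ A).card < N / 4) : ∃ b, 0 < b ∧ b ∈ A ∧ 4 * b ∈ A := by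
  by_contra! hcon
  set S := Finset.Icc 1 N \ A with hS
  have hsub : Finset.Icc 1 (N / 4) ⊆ S ∪ (Finset.Icc 1 (N / 4)).filter fun b => 4 * b ∈ S := by
    intro b hb
    obtain ⟨hb1, hb2⟩ := Finset.mem_Icc.1 hb
    by_cases hbA : b ∈ A
    · refine Finset.mem_union_right _ (Finset.mem_filter.2 ⟨hb, ?_⟩)
      exact Finset.mem_sdiff.2 ⟨Finset.mem_Icc.2 ⟨by omega, by omega⟩, hcon b hb1 hbA⟩
    · exact Finset.mem_union_left _
        (Finset.mem_sdiff.2 ⟨Finset.mem_Icc.2 ⟨by omega, by omega⟩, hbA⟩)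
  have h1 : ((Finset.Icc 1 (N / 4)).filter fun b => 4 * b ∈ S).card ≤ S.card :=
    Finset.card_le_card_of_injOn (fun b => 4 * b) (fun b hb => (Finset.mem_filter.1 hb).2)
      fun b _ b' _ h => by simpa using h
  have h2 := (Finset.card_le_card hsub).trans (Finset.card_union_le _ _)
  rw [Nat.card_Icc] at h2
  omega

lemma HasSquareProductDefect.add_two {k : ℕ} (hk : HasSquareProductDefect k) :
    HasSquareProductDefect (k + 2) := by
  obtain ⟨c, hc, N₀, hN₀⟩ := hk
  refine ⟨min c (1 / 32), by positivity, max N₀ (32 * k + 32), fun N hN A hA hfree => ?_⟩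
  by_contra! hlt
  have hN1 : N₀ ≤ N := (le_max_left _ _).trans hN
  have hN2 : 32 * k + 32 ≤ N := (le_max_right _ _).trans hN
  have hnot : ¬ SquareProductFree k A := fun hf => by
    have h1 := hN₀ N hN1 A hA hf
    have h2 : min c (1 / 32) * N ≤ c * N := by gcongr; exact min_le_left _ _
    linarith
  simp only [SquareProductFree, not_forall, not_not] at hnot
  obtain ⟨B, hBA, hBk, hB⟩ := hnot
  have hsmall : 32 * (Finset.Icc 1 N \ A).card < N := by
    have h2 : min c (1 / 32) * N ≤ 1 / 32 * N := by gcongr; exact min_le_right _ _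
    have h3 : 32 * ((Finset.Icc 1 N \ A).card : ℝ) < N := by linarith
    exact_mod_cast h3
  have hcard : (Finset.Icc 1 N \ (A \ B)).card ≤ (Finset.Icc 1 N \ A).card + k := by
    rw [← hBk]
    refine (Finset.card_le_card ?_).trans (Finset.card_union_le _ _)
    intro n hn
    simp only [Finset.mem_sdiff, Finset.mem_union] at hn ⊢
    tauto
  -- Deleting `B` keeps the new pair disjoint from it and costs only `k` elements, which `N ≥ 32 * k
  -- + 32` absorbs.
  obtain ⟨b, hb, hbA, hbA'⟩ := exists_mem_four_mul_mem (N := N) (A := A \ B) (by omega)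
  rw [Finset.mem_sdiff] at hbA hbA'
  have hne : b ∉ insert (4 * b) B := by
    rw [Finset.mem_insert]; rintro (h | h)
    · omega
    · exact hbA.2 h
  refine hfree (insert b (insert (4 * b) B)) ?_ ?_ ?_
  · exact Finset.insert_subset hbA.1 (Finset.insert_subset hbA'.1 hBA)
  · rw [Finset.card_insert_of_notMem hne, Finset.card_insert_of_notMem hbA'.2, hBk]
  · rw [Finset.prod_insert hne, Finset.prod_insert hbA'.2, ← mul_assoc]
    exact IsSquare.mul ⟨2 * b, by ring⟩ hB

lemma hasSquareProductDefect {k : ℕ} (hk : 4 ≤ k) : HasSquareProductDefect k := by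
  have key : ∀ a m, HasSquareProductDefect a → HasSquareProductDefect (a + 2 * m) := by
    intro a m ha
    induction m with
    | zero => exact ha
    | succ m ih => exact ih.add_two
  rcases Nat.even_or_odd' k with ⟨m, rfl | rfl⟩
  · simpa using key 0 m hasSquareProductDefect_zero
  · obtain ⟨n, rfl⟩ : ∃ n, m = n + 2 := ⟨m - 2, by omega⟩
    convert key 5 n hasSquareProductDefect_five using 1
    ring

/-! ### Consequences for the extremal function -/

lemma sqFreeMax_le (k N : ℕ) : sqFreeMax k N ≤ N := by
  classical
  refine Finset.sup_le fun A hA => ?_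
  have := Finset.card_le_card (Finset.mem_powerset.1 (Finset.mem_filter.1 hA).1)
  simpa using this

lemma HasSquareProductDefect.exists_sqFreeMax_le {k : ℕ} (hk : HasSquareProductDefect k) :
    ∃ c : ℝ, 0 < c ∧ ∀ᶠ N : ℕ in atTop, (sqFreeMax k N : ℝ) ≤ (1 - c) * N := by
  classical
  obtain ⟨c, hc, N₀, hN₀⟩ := hk
  refine ⟨min c 1, by positivity, eventually_atTop.2 ⟨N₀, fun N hN => ?_⟩⟩
  have hpos : 0 ≤ (1 - min c 1) * (N : ℝ) :=
    mul_nonneg (by linarith [min_le_right c 1]) (Nat.cast_nonneg _)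
  -- The supremum is taken in `ℕ`, so the real bound is replaced by its floor.
  rw [← Nat.le_floor_iff hpos]
  refine Finset.sup_le fun A hA => (Nat.le_floor_iff hpos).2 ?_
  obtain ⟨hAN, hfree⟩ := Finset.mem_filter.1 hA
  rw [Finset.mem_powerset] at hAN
  have h1 := hN₀ N hN A hAN hfree
  have h2 : ((Finset.Icc 1 N \ A).card : ℝ) + A.card = N := by
    have := Finset.card_sdiff_add_card_eq_card hAN
    rw [Nat.card_Icc, Nat.add_sub_cancel] at this
    exact_mod_cast this
  have h3 : min c 1 * (N : ℝ) ≤ c * N := by gcongr; exact min_le_left _ _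
  linarith

theorem theorem1p1 (k : ℕ) (hk : 4 ≤ k) :
    (cMinus k ≤ cPlus k ∧ 0 < cMinus k) ∧
    (∃ c : ℝ, 0 < c ∧ ∃ ε : ℕ → ℝ, Tendsto ε atTop (𝓝 0) ∧
      ∀ N : ℕ, (sqFreeMax k N : ℝ) ≤ (1 - c + ε N) * (N : ℝ)) ∧
    (Odd k → ¬ ∃ ε : ℕ → ℝ, Tendsto ε atTop (𝓝 0) ∧
      ∀ᶠ N : ℕ in atTop, (sqFreeMax k N : ℝ) = (1 - ε N) * (N : ℝ)) := by
  obtain ⟨c, hc, hev⟩ := (hasSquareProductDefect hk).exists_sqFreeMax_le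
  have hlow : ∀ᶠ N : ℕ in atTop, c ≤ 1 - (sqFreeMax k N : ℝ) / (N : ℝ) := by
    filter_upwards [hev, eventually_gt_atTop 0] with N hN hN0
    have : (sqFreeMax k N : ℝ) / N ≤ 1 - c := (div_le_iff₀ (by exact_mod_cast hN0)).2 hN
    linarith
  have hup : ∀ᶠ N : ℕ in atTop, 1 - (sqFreeMax k N : ℝ) / (N : ℝ) ≤ 1 :=
    Eventually.of_forall fun N => by
      have : 0 ≤ (sqFreeMax k N : ℝ) / (N : ℝ) := by positivity
      linarith
  have hbelow : IsBoundedUnder (· ≥ ·) atTop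
      fun N : ℕ => 1 - (sqFreeMax k N : ℝ) / (N : ℝ) := ⟨c, by simpa using hlow⟩
  have habove : IsBoundedUnder (· ≤ ·) atTop
      fun N : ℕ => 1 - (sqFreeMax k N : ℝ) / (N : ℝ) := ⟨1, by simpa using hup⟩
  refine ⟨⟨liminf_le_limsup habove hbelow, ?_⟩, ?_, ?_⟩
  · exact hc.trans_le (le_liminf_of_le habove.isCoboundedUnder_ge hlow)
  -- The excess over `1 - c`, cut off at `0`, vanishes for all large `N`.
  · refine ⟨c, hc, fun N => max 0 ((sqFreeMax k N : ℝ) / N - (1 - c)), ?_, fun N => ?_⟩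
    · refine tendsto_const_nhds.congr' ?_
      filter_upwards [hlow] with N hN
      exact (max_eq_left (by linarith)).symm
    · rcases Nat.eq_zero_or_pos N with rfl | hN
      · have := sqFreeMax_le k 0
        simp only [Nat.cast_zero, mul_zero]
        exact_mod_cast this
      · have hN' : (0 : ℝ) < N := by exact_mod_cast hN
        rw [← div_le_iff₀ hN']
        linarith [le_max_right 0 ((sqFreeMax k N : ℝ) / N - (1 - c))]
  · rintro - ⟨ε, hε, heq⟩
    obtain ⟨N, hN1, hN2, hN3, hN4⟩ := (hev.and (heq.and
      ((hε.eventually_lt_const hc).and (eventually_gt_atTop 0)))).exists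
    rw [hN2] at hN1
    have := le_of_mul_le_mul_right hN1 (by exact_mod_cast hN4 : (0 : ℝ) < N)
    linarith
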